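/- Let $\mathbb X=(\mathbb R^n,\|\cdot\|)$ and $\mathbb Y=(\mathbb R^m,\|\cdot\|)$ be finite-dimensional normed spaces with duals $\mathbb X^*,\mathbb Y^*$ (dual norms $\|\cdot\|_*$), let $\mathsf A:\mathbb X\to\mathbb Y^*$ be linear with adjoint $\mathsf A^*:\mathbb Y\to\mathbb X^*$, $\langle \mathsf A^*y,x\rangle=\langle \mathsf Ax,y\rangle$, let $f:\mathbb Y^*\to\mathbb R$ be convex and globally Lipschitz, and let $h:\mathbb X\to\mathbb R\cup\{+\infty\}$ be proper, closed and convex. Write $f^*:\mathbb Y\to\mathbb R\cup\{+\infty\}$ and $h^*:\mathbb X^*\to\mathbb R\cup\{+\infty\}$ for the Fenchel conjugates, $\mathrm{dom}$ for the effective domain, and $$P(x)=f(\mathsf Ax)+h(x),\qquad D(y)=h^*(-\mathsf A^*y)+f^*(y),\qquad D_*=\inf_{y\in\mathbb Y}D(y),\qquad \mathcal U=-\mathsf A^*(\mathrm{cl}\,\mathrm{dom} f^*).$$ Assume: 1. for every nonempty convex compact set $\mathcal S\subseteq\mathrm{dom}\,h$ there is $\mu>0$ such that $h(\lambda x+(1-\lambda)x')\le\lambda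 h(x)+(1-\lambda)h(x')-\frac{\lambda(1-\lambda)\mu}{2}\|x-x'\|^2$ for all $x,x'\in\mathcal S$, $\lambda\in(0,1)$; let $\mu_{\mathcal S}$ be the largest such constant if $\mathcal S$ has at least two points, and $\mu_{\mathcal S}=1$ if $\mathcal S$ is a singleton; 2. $\mathcal U\subseteq\mathrm{int}\,\mathrm{dom}\,h^*$. Let $\alpha_k=k+1$, $\beta_k=k(k+1)/2$ and $\tau_k=\alpha_k/\beta_{k+1}$ for $k\ge0$. Consider the following algorithm (dual averaging with dual monotonicity). Given $\bar s^0\in\mathrm{dom}\,D$, choose $x^0\in\arg\min_{x\in\mathbb X}\{\langle\bar s^0,\mathsf Ax\rangle+h(x)\}$ and $g^0\in\partial f(\mathsf Ax^0)$. At iteration $k\ge0$ set $\hat s^k=(1-\tau_k)\bar s^k+\tau_kg^k$. If $D(\hat s^k)<D(\bar s^k)$, set $\bar s^{k+1}=\hat s^k$ and choose $x^{k+1}\in\arg\min_{x\in\mathbb X}\{\langle\bar s^{k+1},\mathsf Ax\rangle+h(x)\}$ and $g^{k+1}\in\partial f(\mathsf Ax^{k+1})$; otherwise set $(\bar s^{k+1},x^{k+1},g^{k+1})=(\bar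 s^k,x^k,g^k)$. Let $\bar{\mathcal S}=\mathrm{conv}(\nabla h^*(\mathcal U))$, $\bar{\mathcal U}=-\mathsf A^*(\{y\in\mathbb Y: D(y)\le D(\bar s^0)\})$, $\ell=\max\{\|u-u'\|_*: u\in\bar{\mathcal U},\,u'\in\mathcal U\}$ and $\hat x^k\in\arg\min_{x\in\{x^0,\dots,x^k\}}P(x)$. Then, for every $\bar s^0\in\mathrm{dom}\,D$, these quantities are well defined ($\mu_{\bar{\mathcal S}}>0$, the maximum $\ell$ is attained, and $D_*$ is finite and attained), the algorithm is well defined (it has at least one run from $\bar s^0$), and every run satisfies, for all $k\ge1$, $$\min_{0\le i\le k-1}\big(P(x^i)+D(\bar s^i)\big)\le\frac{12}{k^2}\big(D(\bar s^0)-D_*\big)+\frac{26\,\ell^2}{\mu_{\bar{\mathcal S}}\,k}\qquad\text{and}\qquad P(\hat x^k)+D(\bar s^k)\le\frac{2\,\ell^2}{\mu_{\bar{\mathcal S}}\,(k+1)}.$$ -/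

import Mathlib

open Set
open scoped NNReal

namespace DualAveraging

noncomputable section

variable {X Y : Type*} [NormedAddCommGroup X] [NormedSpace ℝ X]
  [NormedAddCommGroup Y] [NormedSpace ℝ Y]

/-- The effective domain of an extended-real-valued function. -/
def effDom {E : Type*} (ψ : E → EReal) : Set E := {e | ψ e < ⊤}

/-- Proper, closed (lower semicontinuous) and convex (convex epigraph) functions
`h : X → ℝ ∪ {+∞}`. -/
structure IsProperClosedConvex (h : X → EReal) : Prop where
  ne_bot : ∀ x, h x ≠ ⊥
  exists_ne_top : ∃ x, h x ≠ ⊤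
  closed : LowerSemicontinuous h
  convex : Convex ℝ {p : X × ℝ | h p.1 ≤ (p.2 : EReal)}

/-- The Fenchel conjugate `h* : X* → ℝ ∪ {+∞}` of `h : X → ℝ ∪ {+∞}`,
`h*(u) = sup_x ⟨u, x⟩ - h x`. -/
def conj (h : X → EReal) (u : StrongDual ℝ X) : EReal :=
  ⨆ x : X, ((u x : ℝ) : EReal) - h x

/-- The Fenchel conjugate `f* : Y → ℝ ∪ {+∞}` of a real-valued function `f : Y* → ℝ`
(`Y` being identified with its bidual), `f*(y) = sup_z ⟨z, y⟩ - f z`. -/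
def conjDual (f : StrongDual ℝ Y → ℝ) (y : Y) : EReal :=
  ⨆ z : StrongDual ℝ Y, ((z y - f z : ℝ) : EReal)

/-- `g ∈ ∂f(z)`, for `f : Y* → ℝ` and `g ∈ Y`. -/
def IsSubgradient (f : StrongDual ℝ Y → ℝ) (z : StrongDual ℝ Y) (g : Y) : Prop :=
  ∀ z' : StrongDual ℝ Y, f z + (z' - z) g ≤ f z'

/-- The primal objective `P(x) = f(A x) + h(x)`. -/
def primalObj (f : StrongDual ℝ Y → ℝ) (h : X → EReal) (A : X →L[ℝ] StrongDual ℝ Y)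
    (x : X) : EReal :=
  ((f (A x) : ℝ) : EReal) + h x

/-- The linear map `-A* : Y → X*`, where `(A* y)(x) = (A x)(y)`. -/
def negAdj (A : X →L[ℝ] StrongDual ℝ Y) (y : Y) : StrongDual ℝ X := -(A.flip y)

/-- The dual objective `D(y) = h*(-A* y) + f*(y)`. -/
def dualObj (f : StrongDual ℝ Y → ℝ) (h : X → EReal) (A : X →L[ℝ] StrongDual ℝ Y)
    (y : Y) : EReal :=
  conj h (negAdj A y) + conjDual f y

/-- The dual optimal value `D_* = inf_y D(y)`. -/
def dualValue (f : StrongDual ℝ Y → ℝ) (h : X → EReal) (A : X →L[ℝ] StrongDual ℝ Y) : EReal :=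
  ⨅ y : Y, dualObj f h A y

/-- `h` is strongly convex on every nonempty convex compact subset of its domain. -/
def LocallyStronglyConvex (h : X → EReal) : Prop :=
  ∀ S : Set X, S.Nonempty → Convex ℝ S → IsCompact S → S ⊆ effDom h →
    ∃ μ : ℝ, 0 < μ ∧ StrongConvexOn S μ (fun x => (h x).toReal)

open Classical in
/-- The tightest strong convexity constant `μ_S` of `h` on `S ⊆ dom h`
(equal to `1` if `S` is a singleton). -/
def strongConvexityConst (h : X → EReal) (S : Set X) : ℝ :=
  if S.Subsingleton then 1
  else sInf {r : ℝ | ∃ x ∈ S, ∃ x' ∈ S, x ≠ x' ∧ ∃ t ∈ Ioo (0 : ℝ) 1,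
    r = (t * (h x).toReal + (1 - t) * (h x').toReal - (h (t • x + (1 - t) • x')).toReal) /
      (t * (1 - t) / 2 * ‖x' - x‖ ^ 2)}

/-- `𝒬 = cl dom f*`. -/
def setQ (f : StrongDual ℝ Y → ℝ) : Set Y := closure (effDom (conjDual f))

/-- `𝒰 = -A*(𝒬)`. -/
def setU (f : StrongDual ℝ Y → ℝ) (A : X →L[ℝ] StrongDual ℝ Y) : Set (StrongDual ℝ X) :=
  negAdj A '' setQ f

/-- `x = ∇h*(u)` at an interior point `u` of `dom h*`, `X` being identified with its bidual. -/
def IsGradConj (h : X → EReal) (u : StrongDual ℝ X) (x : X) : Prop :=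
  u ∈ interior (effDom (conj h)) ∧
    HasFDerivAt (fun v : StrongDual ℝ X => (conj h v).toReal)
      (NormedSpace.inclusionInDoubleDual ℝ X x) u

/-- `𝒮̄ = conv (∇h*(𝒰))`. -/
def setSbar (f : StrongDual ℝ Y → ℝ) (h : X → EReal) (A : X →L[ℝ] StrongDual ℝ Y) : Set X :=
  convexHull ℝ {x | ∃ u ∈ setU f A, IsGradConj h u x}

/-- `𝒰̄ = -A*(ℒ)`, where `ℒ = {y | D(y) ≤ D(s₀)}`. -/
def setUbar (f : StrongDual ℝ Y → ℝ) (h : X → EReal) (A : X →L[ℝ] StrongDual ℝ Y)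
    (s₀ : Y) : Set (StrongDual ℝ X) :=
  negAdj A '' {y | dualObj f h A y ≤ dualObj f h A s₀}

/-- The set of distances between points of `𝒱` and points of `𝒲`. -/
def distances (V W : Set (StrongDual ℝ X)) : Set ℝ :=
  {r | ∃ v ∈ V, ∃ w ∈ W, r = ‖v - w‖}

/-- The furthest distance `ℓ(𝒱, 𝒲) = max {‖v - w‖ | v ∈ 𝒱, w ∈ 𝒲}`. -/
def furthestDist (V W : Set (StrongDual ℝ X)) : ℝ := sSup (distances V W)

/-- `α_k = k + 1`. -/
def stepα (k : ℕ) : ℝ := (k : ℝ) + 1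

/-- `β_k = k (k + 1) / 2`. -/
def stepβ (k : ℕ) : ℝ := (k : ℝ) * ((k : ℝ) + 1) / 2

/-- `τ_k = α_k / β_{k+1}`. -/
def stepτ (k : ℕ) : ℝ := stepα k / stepβ (k + 1)

/-- `x ∈ argmin_{x'} ⟨s, A x'⟩ + h(x')`. -/
def IsProxPoint (h : X → EReal) (A : X →L[ℝ] StrongDual ℝ Y) (s : Y) (x : X) : Prop :=
  ∀ x' : X, (((A x) s : ℝ) : EReal) + h x ≤ (((A x') s : ℝ) : EReal) + h x'

/-- The trial iterate `ŝ^k = (1 - τ_k) s̄^k + τ_k g^k`. -/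
def trial (s g : ℕ → Y) (k : ℕ) : Y := (1 - stepτ k) • s k + stepτ k • g k

/-- `(s, x, g) = (s̄^k, x^k, g^k)_{k ≥ 0}` is a sequence generated by dual averaging with dual
monotonicity from the initial dual iterate `s₀ ∈ dom D`. -/
structure IsMonotoneDARun (f : StrongDual ℝ Y → ℝ) (h : X → EReal)
    (A : X →L[ℝ] StrongDual ℝ Y) (s₀ : Y) (s : ℕ → Y) (x : ℕ → X) (g : ℕ → Y) : Prop where
  feasible : s₀ ∈ effDom (dualObj f h A)
  init_s : s 0 = s₀
  init_x : IsProxPoint h A (s 0) (x 0)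
  init_g : IsSubgradient f (A (x 0)) (g 0)
  active : ∀ k, dualObj f h A (trial s g k) < dualObj f h A (s k) →
    s (k + 1) = trial s g k ∧ IsProxPoint h A (s (k + 1)) (x (k + 1)) ∧
      IsSubgradient f (A (x (k + 1))) (g (k + 1))
  idle : ∀ k, ¬ dualObj f h A (trial s g k) < dualObj f h A (s k) →
    s (k + 1) = s k ∧ x (k + 1) = x k ∧ g (k + 1) = g k

/-- `x̂ ∈ argmin {P(x) | x ∈ {x^0, …, x^k}}`. -/
def IsBestIterate (f : StrongDual ℝ Y → ℝ) (h : X → EReal) (A : X →L[ℝ] StrongDual ℝ Y)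
    (x : ℕ → X) (k : ℕ) (xhat : X) : Prop :=
  (∃ i ≤ k, xhat = x i) ∧ ∀ i ≤ k, primalObj f h A xhat ≤ primalObj f h A (x i)

end

end DualAveraging

/-!
The method is a generalized conditional gradient (Frank–Wolfe) method on the dual objective
`D = h* ∘ (-A*) + f*`, and the proof rests on three facts.

*Smoothness.* For `u` in a compact subset of `int dom h*`, the function `h - u` is uniformly
coercive (`exists_coercive`), so it has minimizers, and these lie in a convex compact subset of
`dom h` (`exists_strongConvexOn_maximizers`), on which `h` is strongly convex by hypothesis. If `h`
is strongly convex with constant `μ` on a convex set containing the minimizers for `u` and `v`, then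
`h*(v) ≤ h*(u) + ⟨v - u, x⟩ + ‖v - u‖² / (2μ)`, where `x` is the minimizer for `u`
(`toReal_conj_le_quadratic`). On a ball around `u` this shows that `∇h*(u)` exists and is that
minimizer; on `𝒰` it shows that `conv (∇h*(𝒰))` contains all the primal iterates, has `μ > 0`, and
gives the smoothness of `h*` along `𝒰` with the tightest constant.

*Descent.* Since `f*(g) - ⟨g, A x⟩ = -f(A x)` for a subgradient `g ∈ ∂f(A x)`, smoothness and the
convexity of `f*` give `D(ŝ) ≤ D(s) - τ (P(x) + D(s)) + τ² ℓ² / (2μ)` (`dual_descent`). The monotone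
rule preserves this inequality: in an idle step the new dual value is at most the trial one.

*Summation.* Multiplying by `β_{k+1}`, with `β_{k+1} τ_k = α_k` and `β_{k+1} - α_k = β_k`,
telescopes the recursion. Keeping the primal values yields the bound on `P(x̂) + D(s)`, hence also
`D(s^k) - D_* = O(1/k)` by weak duality. Keeping the gaps `P(x^i) + D(s^i)` leaves the terms
`α_k (D(s^k) - D_*)`, which that decay bounds, and yields the bound on the smallest gap.
-/

namespace DualAveraging

variable {E : Type*} [NormedAddCommGroup E] [NormedSpace ℝ E]

/-! ### Fenchel conjugates in real-valued terms -/

lemma mem_effDom_iff {ι : Type*} {ψ : ι → EReal} {e : ι} : e ∈ effDom ψ ↔ ψ e ≠ ⊤ :=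
  lt_top_iff_ne_top (a := ψ e)

lemma IsProperClosedConvex.coe_toReal {h : E → EReal} (hh : IsProperClosedConvex h) {x : E}
    (hx : x ∈ effDom h) : (((h x).toReal : ℝ) : EReal) = h x :=
  EReal.coe_toReal (mem_effDom_iff.1 hx) (hh.ne_bot x)

lemma IsProperClosedConvex.nonempty_effDom {h : E → EReal} (hh : IsProperClosedConvex h) :
    (effDom h).Nonempty := by
  obtain ⟨x, hx⟩ := hh.exists_ne_top
  exact ⟨x, mem_effDom_iff.2 hx⟩

lemma IsProperClosedConvex.convex_sublevel {h : E → EReal} (hh : IsProperClosedConvex h) (c : ℝ) :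
    Convex ℝ {x | h x ≤ (c : EReal)} := by
  intro x hx y hy a b ha hb hab
  have := hh.convex (show (x, c) ∈ {p : E × ℝ | h p.1 ≤ (p.2 : EReal)} from hx)
    (show (y, c) ∈ {p : E × ℝ | h p.1 ≤ (p.2 : EReal)} from hy) ha hb hab
  simpa [← add_mul, hab] using this

lemma conj_le_coe_iff {h : E → EReal} (hh : IsProperClosedConvex h) {u : StrongDual ℝ E} {c : ℝ} :
    conj h u ≤ (c : EReal) ↔ ∀ x ∈ effDom h, u x - (h x).toReal ≤ c := by
  refine iSup_le_iff.trans (forall_congr' fun x => ?_)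
  by_cases hx : x ∈ effDom h
  · rw [← hh.coe_toReal hx]
    simp only [hx, EReal.toReal_coe, forall_const]
    exact_mod_cast Iff.rfl
  · have : h x = ⊤ := by simpa [mem_effDom_iff] using hx
    simp [hx, this]

lemma le_conj {h : E → EReal} (hh : IsProperClosedConvex h) (u : StrongDual ℝ E) {x : E}
    (hx : x ∈ effDom h) : ((u x - (h x).toReal : ℝ) : EReal) ≤ conj h u := by
  refine le_trans (le_of_eq ?_) (le_iSup _ x)
  rw [EReal.coe_sub, hh.coe_toReal hx]

lemma conj_ne_bot {h : E → EReal} (hh : IsProperClosedConvex h) (u : StrongDual ℝ E) :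
    conj h u ≠ ⊥ := by
  obtain ⟨x, hx⟩ := hh.nonempty_effDom
  exact ne_bot_of_le_ne_bot (EReal.coe_ne_bot _) (le_conj hh u hx)

lemma coe_toReal_conj {h : E → EReal} (hh : IsProperClosedConvex h) {u : StrongDual ℝ E}
    (hu : u ∈ effDom (conj h)) : (((conj h u).toReal : ℝ) : EReal) = conj h u :=
  EReal.coe_toReal (mem_effDom_iff.1 hu) (conj_ne_bot hh u)

/-- The Fenchel–Young inequality. -/
lemma sub_le_toReal_conj {h : E → EReal} (hh : IsProperClosedConvex h) {u : StrongDual ℝ E}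
    (hu : u ∈ effDom (conj h)) {x : E} (hx : x ∈ effDom h) :
    u x - (h x).toReal ≤ (conj h u).toReal := by
  have := le_conj hh u hx
  rw [← coe_toReal_conj hh hu] at this
  exact_mod_cast this

lemma convexOn_toReal_conj {h : E → EReal} (hh : IsProperClosedConvex h) :
    ConvexOn ℝ (effDom (conj h)) fun u => (conj h u).toReal := by
  have key : ∀ ⦃u⦄, u ∈ effDom (conj h) → ∀ ⦃v⦄, v ∈ effDom (conj h) → ∀ ⦃a b : ℝ⦄, 0 ≤ a →
      0 ≤ b → a + b = 1 → conj h (a • u + b • v) ≤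
        ((a * (conj h u).toReal + b * (conj h v).toReal : ℝ) : EReal) := by
    intro u hu v hv a b ha hb hab
    rw [conj_le_coe_iff hh]
    intro x hx
    have h1 := mul_le_mul_of_nonneg_left (sub_le_toReal_conj hh hu hx) ha
    have h2 := mul_le_mul_of_nonneg_left (sub_le_toReal_conj hh hv hx) hb
    have h3 : (h x).toReal = a * (h x).toReal + b * (h x).toReal := by rw [← add_mul, hab, one_mul]
    simp only [add_apply, smul_apply, smul_eq_mul]
    linarith
  have hc : Convex ℝ (effDom (conj h)) := fun u hu v hv a b ha hb hab =>
    lt_of_le_of_lt (key hu hv ha hb hab) (EReal.coe_lt_top _)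
  refine ⟨hc, fun u hu v hv a b ha hb hab => ?_⟩
  have := key hu hv ha hb hab
  rw [← coe_toReal_conj hh (hc hu hv ha hb hab)] at this
  exact_mod_cast this

lemma lowerSemicontinuous_conj {h : E → EReal} (hh : IsProperClosedConvex h) :
    LowerSemicontinuous (conj h) := by
  refine lowerSemicontinuous_iSup fun x => Continuous.lowerSemicontinuous ?_
  by_cases hx : x ∈ effDom h
  · rw [← hh.coe_toReal hx]
    have : Continuous fun u : StrongDual ℝ E => ((u x - (h x).toReal : ℝ) : EReal) :=
      continuous_coe_real_ereal.comp (by fun_prop)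
    simpa only [EReal.coe_sub] using this
  · have : h x = ⊤ := by simpa [mem_effDom_iff] using hx
    simpa [this] using continuous_const

/-! ### Maximizers in the conjugate -/

/-- `x` attains the supremum `h*(u) = sup_x ⟨u, x⟩ - h x`, with `h x` finite. -/
def IsConjMaximizer (h : E → EReal) (u : StrongDual ℝ E) (x : E) : Prop :=
  x ∈ effDom h ∧ ∀ x' ∈ effDom h, u x' - (h x').toReal ≤ u x - (h x).toReal

lemma IsConjMaximizer.conj_eq {h : E → EReal} (hh : IsProperClosedConvex h) {u : StrongDual ℝ E}
    {x : E} (hx : IsConjMaximizer h u x) : conj h u = ((u x - (h x).toReal : ℝ) : EReal) :=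
  le_antisymm ((conj_le_coe_iff hh).2 hx.2) (le_conj hh u hx.1)

lemma IsConjMaximizer.toReal_conj_eq {h : E → EReal} (hh : IsProperClosedConvex h)
    {u : StrongDual ℝ E} {x : E} (hx : IsConjMaximizer h u x) :
    (conj h u).toReal = u x - (h x).toReal := by
  rw [hx.conj_eq hh, EReal.toReal_coe]

/-- Uniform coercivity of `h - u` as `u` runs through a compact subset of `int dom h*`: a bound
for `h*` on a thickening of that set is a growth bound for `h`. -/
lemma exists_coercive [FiniteDimensional ℝ E] {h : E → EReal} (hh : IsProperClosedConvex h)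
    {K : Set (StrongDual ℝ E)} (hK : IsCompact K) (hKi : K ⊆ interior (effDom (conj h))) :
    ∃ ε > 0, ∃ C : ℝ, ∀ u ∈ K, ∀ x ∈ effDom h, ε * ‖x‖ - C ≤ (h x).toReal - u x := by
  obtain ⟨ε, hε, hsub⟩ := hK.exists_cthickening_subset_open isOpen_interior hKi
  have hc : ContinuousOn (fun u => (conj h u).toReal) (Metric.cthickening ε K) :=
    (convexOn_toReal_conj hh).continuousOn_interior.mono hsub
  obtain ⟨C, hC⟩ := (hK.cthickening (r := ε)).bddAbove_image hc
  refine ⟨ε, hε, C, fun u hu x hx => ?_⟩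
  obtain ⟨g, hg1, hgx⟩ := exists_dual_vector'' ℝ x
  have hmem : u + ε • g ∈ Metric.cthickening ε K := by
    refine Metric.mem_cthickening_of_dist_le _ u ε K hu ?_
    rw [dist_eq_norm, add_sub_cancel_left, norm_smul, Real.norm_of_nonneg hε.le]
    exact mul_le_of_le_one_right hε.le hg1
  have h1 := sub_le_toReal_conj hh (interior_subset (hsub hmem)) hx
  have h2 : (conj h (u + ε • g)).toReal ≤ C := hC ⟨_, hmem, rfl⟩
  have h3 : g x = ‖x‖ := by simpa using hgx
  simp only [add_apply, smul_apply, smul_eq_mul, h3] at h1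
  linarith

lemma exists_isConjMaximizer [FiniteDimensional ℝ E] {h : E → EReal} (hh : IsProperClosedConvex h)
    {u : StrongDual ℝ E} (hu : u ∈ interior (effDom (conj h))) : ∃ x, IsConjMaximizer h u x := by
  obtain ⟨ε, hε, C, hC⟩ := exists_coercive hh (isCompact_singleton (x := u))
    (singleton_subset_iff.2 hu)
  obtain ⟨x₀, hx₀⟩ := hh.nonempty_effDom
  have := FiniteDimensional.proper_real E
  -- outside the ball of radius `R`, coercivity keeps `h - u` above its value at `x₀`
  set R := max ‖x₀‖ (((h x₀).toReal - u x₀ + C) / ε) with hR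
  have hlsc : LowerSemicontinuous fun x => h x + ((-u x : ℝ) : EReal) := by
    refine hh.closed.add' (continuous_coe_real_ereal.comp (by fun_prop)).lowerSemicontinuous
      fun x => EReal.continuousAt_add (Or.inr (EReal.coe_ne_bot _)) (Or.inr (EReal.coe_ne_top _))
  have hx₀R : x₀ ∈ Metric.closedBall (0 : E) R := by simp [hR]
  obtain ⟨x, -, hmin⟩ := (hlsc.lowerSemicontinuousOn _).exists_isMinOn ⟨x₀, hx₀R⟩
    (isCompact_closedBall (0 : E) R)
  have hfin : ∀ z ∈ effDom h, h z + ((-u z : ℝ) : EReal) = (((h z).toReal - u z : ℝ) : EReal) := by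
    intro z hz
    rw [sub_eq_add_neg, EReal.coe_add, hh.coe_toReal hz]
  have hxd : x ∈ effDom h := by
    have h1 : h x + ((-u x : ℝ) : EReal) ≤ h x₀ + ((-u x₀ : ℝ) : EReal) := hmin hx₀R
    rw [hfin x₀ hx₀] at h1
    rw [mem_effDom_iff]
    intro htop
    rw [htop, EReal.top_add_coe] at h1
    exact absurd h1 (not_le.2 (EReal.coe_lt_top _))
  have hle : ∀ z ∈ Metric.closedBall (0 : E) R, z ∈ effDom h →
      (h x).toReal - u x ≤ (h z).toReal - u z := by
    intro z hz hzd
    have h1 : h x + ((-u x : ℝ) : EReal) ≤ h z + ((-u z : ℝ) : EReal) := hmin hz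
    rw [hfin z hzd, hfin x hxd] at h1
    exact_mod_cast h1
  refine ⟨x, hxd, fun z hz => ?_⟩
  by_cases hzR : z ∈ Metric.closedBall (0 : E) R
  · linarith [hle z hzR hz]
  · have h1 := hle x₀ hx₀R hx₀
    have h2 := hC u rfl z hz
    have h3 : ((h x₀).toReal - u x₀ + C) / ε < ‖z‖ :=
      lt_of_le_of_lt (le_max_right _ _) (not_le.1 (mem_closedBall_zero_iff.not.1 hzR))
    rw [div_lt_iff₀ hε] at h3
    linarith

/-- The maximizers belonging to a compact subset of `int dom h*` are bounded, and `h` is bounded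
above on them. They therefore lie in the intersection of a closed ball with a sublevel set of `h`,
which is convex, compact by lower semicontinuity, and contained in `dom h`. -/
lemma exists_strongConvexOn_maximizers [FiniteDimensional ℝ E] {h : E → EReal}
    (hh : IsProperClosedConvex h) (hs : LocallyStronglyConvex h)
    {K : Set (StrongDual ℝ E)} (hK : IsCompact K) (hKne : K.Nonempty)
    (hKi : K ⊆ interior (effDom (conj h))) :
    ∃ S : Set E, Convex ℝ S ∧ S ⊆ effDom h ∧ (∀ u ∈ K, ∀ x, IsConjMaximizer h u x → x ∈ S) ∧
      ∃ μ : ℝ, 0 < μ ∧ StrongConvexOn S μ fun x => (h x).toReal := by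
  obtain ⟨ε, hε, C, hC⟩ := exists_coercive hh hK hKi
  obtain ⟨x₀, hx₀⟩ := hh.nonempty_effDom
  have := FiniteDimensional.proper_real E
  obtain ⟨B, hB⟩ := hK.isBounded.exists_norm_le
  have hB0 : 0 ≤ B := (norm_nonneg _).trans (hB _ hKne.some_mem)
  have hup : ∀ u ∈ K, ∀ x : E, |u x| ≤ B * ‖x‖ := fun u hu x =>
    (u.le_opNorm x).trans (mul_le_mul_of_nonneg_right (hB u hu) (norm_nonneg _))
  set R := ((h x₀).toReal + B * ‖x₀‖ + C) / ε with hR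
  set T := (h x₀).toReal + B * ‖x₀‖ + B * R with hT
  set S := Metric.closedBall (0 : E) R ∩ {x | h x ≤ (T : EReal)} with hS
  have hmem : ∀ u ∈ K, ∀ x, IsConjMaximizer h u x → x ∈ S := by
    intro u hu x hx
    have h1 := hC u hu x hx.1
    have h2 := hx.2 x₀ hx₀
    have h3 := (abs_le.1 (hup u hu x₀)).1
    have h4 := (abs_le.1 (hup u hu x)).2
    have hxR : ‖x‖ ≤ R := by
      rw [hR, le_div_iff₀ hε]
      linarith
    refine ⟨by simpa using hxR, ?_⟩
    have h5 : B * ‖x‖ ≤ B * R := mul_le_mul_of_nonneg_left hxR hB0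
    show h x ≤ (T : EReal)
    rw [← hh.coe_toReal hx.1]
    exact_mod_cast (by linarith : (h x).toReal ≤ T)
  have hconv : Convex ℝ S := (convex_closedBall _ _).inter (hh.convex_sublevel T)
  have hdom : S ⊆ effDom h := fun x hx => lt_of_le_of_lt hx.2 (EReal.coe_lt_top T)
  have hcomp : IsCompact S :=
    (isCompact_closedBall (0 : E) R).inter_right (hh.closed.isClosed_preimage (T : EReal))
  obtain ⟨u, hu⟩ := hKne
  obtain ⟨x, hx⟩ := exists_isConjMaximizer hh (hKi hu)
  exact ⟨S, hconv, hdom, hmem, hs S ⟨x, hmem u hu x hx⟩ hconv hcomp hdom⟩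

/-- A minimizer `x` of a strongly convex function minus a linear form has quadratic growth. -/
lemma IsConjMaximizer.quadratic_growth {h : E → EReal} {S : Set E} {μ : ℝ}
    (hSd : S ⊆ effDom h) (hS : StrongConvexOn S μ fun x => (h x).toReal)
    {u : StrongDual ℝ E} {x z : E} (hx : IsConjMaximizer h u x) (hxS : x ∈ S) (hz : z ∈ S) :
    μ / 2 * ‖x - z‖ ^ 2 ≤ ((h z).toReal - u z) - ((h x).toReal - u x) := by
  -- compare `x` with `(1 - t) x + t z`, divide by `t` and let `t → 0`
  have key : ∀ t ∈ Ioo (0 : ℝ) 1, (1 - t) * (μ / 2 * ‖x - z‖ ^ 2) ≤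
      ((h z).toReal - u z) - ((h x).toReal - u x) := by
    intro t ht
    have h1 := hS.2 hxS hz (sub_nonneg.2 ht.2.le) ht.1.le (by ring)
    have h2 := hx.2 _ (hSd (hS.1 hxS hz (sub_nonneg.2 ht.2.le) ht.1.le (by ring)))
    simp only [map_add, map_smul, smul_eq_mul] at h1 h2
    refine le_of_mul_le_mul_left ?_ ht.1
    linarith
  have hlim : Filter.Tendsto (fun t : ℝ => (1 - t) * (μ / 2 * ‖x - z‖ ^ 2))
      (nhdsWithin 0 (Ioi 0)) (nhds ((1 - 0) * (μ / 2 * ‖x - z‖ ^ 2))) :=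
    (Continuous.tendsto (by fun_prop) 0).mono_left nhdsWithin_le_nhds
  rw [sub_zero, one_mul] at hlim
  refine le_of_tendsto hlim ?_
  filter_upwards [Ioo_mem_nhdsGT (zero_lt_one' ℝ)] with t ht using key t ht

/-- Strong convexity of `h` with constant `μ` on a set containing the maximizers makes `h*` smooth
with constant `1 / μ`. -/
lemma toReal_conj_le_quadratic {h : E → EReal} (hh : IsProperClosedConvex h) {S : Set E} {μ : ℝ}
    (hμ : 0 < μ) (hSd : S ⊆ effDom h) (hS : StrongConvexOn S μ fun x => (h x).toReal)
    {u v : StrongDual ℝ E} {x z : E} (hx : IsConjMaximizer h u x) (hxS : x ∈ S)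
    (hz : IsConjMaximizer h v z) (hzS : z ∈ S) :
    (conj h v).toReal ≤ (conj h u).toReal + (v - u) x + ‖v - u‖ ^ 2 / (2 * μ) := by
  have h1 := hx.quadratic_growth hSd hS hxS hzS
  have h2 : (v - u) (z - x) ≤ ‖v - u‖ * ‖x - z‖ := by
    rw [norm_sub_rev x z]
    exact (le_abs_self _).trans ((v - u).le_opNorm _)
  have h3 : ‖v - u‖ * ‖x - z‖ ≤ ‖v - u‖ ^ 2 / (2 * μ) + μ / 2 * ‖x - z‖ ^ 2 := by
    have : ‖v - u‖ ^ 2 / (2 * μ) + μ / 2 * ‖x - z‖ ^ 2 - ‖v - u‖ * ‖x - z‖ =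
        (‖v - u‖ - μ * ‖x - z‖) ^ 2 / (2 * μ) := by
      field_simp
      ring
    have : 0 ≤ (‖v - u‖ - μ * ‖x - z‖) ^ 2 / (2 * μ) := by positivity
    linarith
  rw [hx.toReal_conj_eq hh, hz.toReal_conj_eq hh]
  simp only [sub_apply, map_sub] at h2 ⊢
  linarith

/-- A maximizer at an interior point of `dom h*` is the gradient of `h*`: the Fenchel–Young
inequality bounds `h*` below by its linearization, and smoothness on a compact ball around `u`
bounds it above up to a quadratic error. -/
lemma IsConjMaximizer.isGradConj [FiniteDimensional ℝ E] {h : E → EReal}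
    (hh : IsProperClosedConvex h) (hs : LocallyStronglyConvex h) {u : StrongDual ℝ E}
    (hu : u ∈ interior (effDom (conj h))) {x : E} (hx : IsConjMaximizer h u x) :
    IsGradConj h u x := by
  refine ⟨hu, ?_⟩
  obtain ⟨r, hr, hsub⟩ := Metric.nhds_basis_closedBall.mem_iff.1 (isOpen_interior.mem_nhds hu)
  have := FiniteDimensional.proper_real (StrongDual ℝ E)
  obtain ⟨S, -, hSd, hmem, μ, hμ, hS⟩ := exists_strongConvexOn_maximizers hh hs
    (isCompact_closedBall u r) ⟨u, Metric.mem_closedBall_self hr.le⟩ hsub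
  rw [hasFDerivAt_iff_isLittleO]
  have hO : (fun v => (conj h v).toReal - (conj h u).toReal -
      NormedSpace.inclusionInDoubleDual ℝ E x (v - u)) =O[nhds u]
        fun v => ‖v - u‖ ^ 2 := by
    refine Asymptotics.IsBigO.of_bound (1 / (2 * μ)) ?_
    filter_upwards [Metric.closedBall_mem_nhds u hr] with v hv
    obtain ⟨z, hz⟩ := exists_isConjMaximizer hh (hsub hv)
    have h1 := toReal_conj_le_quadratic hh hμ hSd hS hx
      (hmem u (Metric.mem_closedBall_self hr.le) x hx) hz (hmem v hv z hz)
    have h2 := sub_le_toReal_conj hh (interior_subset (hsub hv)) hx.1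
    have h3 := hx.toReal_conj_eq hh
    rw [NormedSpace.dual_def, Real.norm_of_nonneg, Real.norm_of_nonneg (by positivity)]
    · rw [one_div_mul_eq_div]
      linarith
    · simp only [sub_apply]
      linarith
  refine hO.trans_isLittleO ?_
  have h1 : (fun v : StrongDual ℝ E => v - u) =o[nhds u] fun _ => (1 : ℝ) := by
    rw [Asymptotics.isLittleO_one_iff]
    exact (continuous_id.sub continuous_const).tendsto' u 0 (sub_self u)
  have h2 := h1.norm_left.mul_isBigO (Asymptotics.isBigO_refl (fun v => ‖v - u‖) (nhds u))
  simp only [one_mul, ← pow_two] at h2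
  exact Asymptotics.isLittleO_norm_right.1 h2

lemma isGradConj_iff_isConjMaximizer [FiniteDimensional ℝ E] {h : E → EReal}
    (hh : IsProperClosedConvex h) (hs : LocallyStronglyConvex h) {u : StrongDual ℝ E}
    (hu : u ∈ interior (effDom (conj h))) {x : E} : IsGradConj h u x ↔ IsConjMaximizer h u x := by
  refine ⟨fun hg => ?_, fun hx => hx.isGradConj hh hs hu⟩
  obtain ⟨z, hz⟩ := exists_isConjMaximizer hh hu
  have heq := hg.2.unique (hz.isGradConj hh hs hu).2
  have : x = z := (NormedSpace.inclusionInDoubleDualLi (E := E) ℝ).injective heq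
  exact this ▸ hz

/-- The tightest constant `μ_S` is a strong convexity constant on `S`, and it is positive as soon
as some positive constant works. -/
lemma strongConvexityConst_pos_and_strongConvexOn {h : E → EReal} {S : Set E} {ν : ℝ} (hν : 0 < ν)
    (hS : StrongConvexOn S ν fun x => (h x).toReal) :
    0 < strongConvexityConst h S ∧
      StrongConvexOn S (strongConvexityConst h S) fun x => (h x).toReal := by
  by_cases hsub : S.Subsingleton
  · refine ⟨by simp [strongConvexityConst, hsub], hS.1, fun x hx y hy a b ha hb hab => ?_⟩
    obtain rfl := hsub hx hy
    simp [← add_smul, ← add_mul, hab]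
  have hdef : strongConvexityConst h S = _ := if_neg hsub
  set Q := {r : ℝ | ∃ x ∈ S, ∃ x' ∈ S, x ≠ x' ∧ ∃ t ∈ Ioo (0 : ℝ) 1,
    r = (t * (h x).toReal + (1 - t) * (h x').toReal - (h (t • x + (1 - t) • x')).toReal) /
      (t * (1 - t) / 2 * ‖x' - x‖ ^ 2)} with hQ
  have hpos : ∀ x x' : E, x ≠ x' → ∀ t ∈ Ioo (0 : ℝ) 1, 0 < t * (1 - t) / 2 * ‖x' - x‖ ^ 2 := by
    intro x x' hne t ht
    have h1 : 0 < ‖x' - x‖ := norm_pos_iff.2 (sub_ne_zero.2 hne.symm)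
    have h2 := sub_pos.2 ht.2
    have h3 := ht.1
    positivity
  have hlow : ∀ r ∈ Q, ν ≤ r := by
    rintro r ⟨x, hx, x', hx', hne, t, ht, rfl⟩
    rw [le_div_iff₀ (hpos x x' hne t ht)]
    have := hS.2 hx hx' ht.1.le (sub_nonneg.2 ht.2.le) (by ring)
    simp only [smul_eq_mul] at this
    rw [norm_sub_rev x' x]
    linarith
  have hne : Q.Nonempty := by
    obtain ⟨x, hx, y, hy, hxy⟩ := not_subsingleton_iff.1 hsub
    exact ⟨_, x, hx, y, hy, hxy, 1 / 2, by constructor <;> norm_num, rfl⟩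
  rw [hdef]
  refine ⟨hν.trans_le (le_csInf hne hlow), hS.1, fun x hx y hy a b ha hb hab => ?_⟩
  rcases eq_or_ne x y with rfl | hxy
  · simp [← add_smul, ← add_mul, hab]
  rcases ha.eq_or_lt with rfl | ha'
  · obtain rfl : b = 1 := by linarith
    simp
  rcases hb.eq_or_lt with rfl | hb'
  · obtain rfl : a = 1 := by linarith
    simp
  obtain rfl : b = 1 - a := by linarith
  have ht : a ∈ Ioo (0 : ℝ) 1 := ⟨ha', by linarith⟩
  have h1 : sInf Q ≤ _ := csInf_le ⟨ν, hlow⟩ ⟨x, hx, y, hy, hxy, a, ht, rfl⟩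
  rw [le_div_iff₀ (hpos x y hxy a ht), norm_sub_rev y x] at h1
  simp only [smul_eq_mul]
  linarith

/-! ### The conjugate of a finite convex Lipschitz function on the dual -/

section Dual

variable {Y : Type*} [NormedAddCommGroup Y] [NormedSpace ℝ Y]

lemma isProperClosedConvex_coe {Z : Type*} [NormedAddCommGroup Z] [NormedSpace ℝ Z] {f : Z → ℝ}
    (hf : ConvexOn ℝ univ f) (hfc : Continuous f) :
    IsProperClosedConvex fun z => (f z : EReal) where
  ne_bot _ := EReal.coe_ne_bot _
  exists_ne_top := ⟨0, EReal.coe_ne_top _⟩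
  closed := (continuous_coe_real_ereal.comp hfc).lowerSemicontinuous
  convex := by simpa using hf.convex_epigraph

/-- `f*` on `Y` is the restriction along `Y → Y**` of the conjugate on the bidual. -/
lemma conjDual_eq_conj (f : StrongDual ℝ Y → ℝ) (y : Y) :
    conjDual f y = conj (fun z => (f z : EReal)) (NormedSpace.inclusionInDoubleDual ℝ Y y) := by
  simp [conjDual, conj]

/-- Equality in the Fenchel–Young inequality at a subgradient. -/
lemma IsSubgradient.conjDual_eq {f : StrongDual ℝ Y → ℝ} {z : StrongDual ℝ Y} {g : Y}
    (hg : IsSubgradient f z g) : conjDual f g = ((z g - f z : ℝ) : EReal) := by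
  refine le_antisymm (iSup_le fun z' => ?_)
    (le_iSup (fun z : StrongDual ℝ Y => ((z g - f z : ℝ) : EReal)) z)
  have := hg z'
  rw [sub_apply] at this
  exact EReal.coe_le_coe_iff.2 (by linarith)

lemma IsSubgradient.toReal_conjDual_eq {f : StrongDual ℝ Y → ℝ} {z : StrongDual ℝ Y} {g : Y}
    (hg : IsSubgradient f z g) : (conjDual f g).toReal = z g - f z := by
  rw [hg.conjDual_eq, EReal.toReal_coe]

lemma IsSubgradient.mem_effDom_conjDual {f : StrongDual ℝ Y → ℝ} {z : StrongDual ℝ Y} {g : Y}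
    (hg : IsSubgradient f z g) : g ∈ effDom (conjDual f) := by
  rw [mem_effDom_iff, hg.conjDual_eq]
  exact EReal.coe_ne_top _

lemma conjDual_ne_bot (f : StrongDual ℝ Y → ℝ) (y : Y) : conjDual f y ≠ ⊥ :=
  ne_bot_of_le_ne_bot (EReal.coe_ne_bot _)
    (le_iSup (fun z : StrongDual ℝ Y => ((z y - f z : ℝ) : EReal)) 0)

lemma coe_toReal_conjDual {f : StrongDual ℝ Y → ℝ} {y : Y} (hy : y ∈ effDom (conjDual f)) :
    (((conjDual f y).toReal : ℝ) : EReal) = conjDual f y :=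
  EReal.coe_toReal (mem_effDom_iff.1 hy) (conjDual_ne_bot f y)

lemma sub_le_toReal_conjDual {f : StrongDual ℝ Y → ℝ} {y : Y} (hy : y ∈ effDom (conjDual f))
    (z : StrongDual ℝ Y) : z y - f z ≤ (conjDual f y).toReal := by
  have h1 : ((z y - f z : ℝ) : EReal) ≤ conjDual f y :=
    le_iSup (fun z : StrongDual ℝ Y => ((z y - f z : ℝ) : EReal)) z
  rw [← coe_toReal_conjDual hy] at h1
  exact_mod_cast h1

lemma convexOn_toReal_conjDual {f : StrongDual ℝ Y → ℝ} (hf : ConvexOn ℝ univ f)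
    (hfc : Continuous f) : ConvexOn ℝ (effDom (conjDual f)) fun y => (conjDual f y).toReal := by
  have h1 := (convexOn_toReal_conj (isProperClosedConvex_coe hf hfc)).comp_linearMap
    (NormedSpace.inclusionInDoubleDual ℝ Y).toLinearMap
  have h2 : effDom (conjDual f) = (NormedSpace.inclusionInDoubleDual ℝ Y).toLinearMap ⁻¹'
      effDom (conj fun z => (f z : EReal)) := by
    ext y
    simp [effDom, conjDual_eq_conj]
  rw [h2]
  refine h1.congr fun y _ => ?_
  simp [conjDual_eq_conj]

lemma lowerSemicontinuous_conjDual {f : StrongDual ℝ Y → ℝ} (hf : ConvexOn ℝ univ f)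
    (hfc : Continuous f) : LowerSemicontinuous (conjDual f) := by
  have := (lowerSemicontinuous_conj (isProperClosedConvex_coe hf hfc)).comp
    (NormedSpace.inclusionInDoubleDual ℝ Y).continuous
  rwa [show conjDual f = _ from funext (conjDual_eq_conj f)]

/-- The domain of `f*` lies in the ball whose radius is the Lipschitz constant of `f`. -/
lemma norm_le_of_mem_effDom_conjDual {f : StrongDual ℝ Y → ℝ} {L : ℝ≥0} (hf : LipschitzWith L f)
    {y : Y} (hy : y ∈ effDom (conjDual f)) : ‖y‖ ≤ L := by
  obtain ⟨z, hz1, hzy⟩ := exists_dual_vector'' ℝ y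
  have hzy' : z y = ‖y‖ := by simpa using hzy
  -- along the ray `t ↦ t z` the affine minorant of slope `‖y‖ - L` stays bounded
  have key : ∀ t : ℝ, 0 ≤ t → t * (‖y‖ - L) ≤ (conjDual f y).toReal + f 0 := by
    intro t ht
    have h1 := sub_le_toReal_conjDual hy (t • z)
    have h2 : f (t • z) - f 0 ≤ L * ‖t • z - 0‖ := by
      have := hf.dist_le_mul (t • z) 0
      rw [Real.dist_eq, dist_eq_norm] at this
      exact (le_abs_self _).trans this
    rw [sub_zero, norm_smul, Real.norm_of_nonneg ht] at h2
    have h3 : (L : ℝ) * (t * ‖z‖) ≤ L * (t * 1) := by gcongr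
    simp only [smul_apply, smul_eq_mul, hzy'] at h1
    linarith
  by_contra! hlt
  have h4 := sub_pos.2 hlt
  have h5 := key ((|(conjDual f y).toReal + f 0| + 1) / (‖y‖ - L)) (by positivity)
  rw [div_mul_cancel₀ _ h4.ne'] at h5
  linarith [le_abs_self ((conjDual f y).toReal + f 0)]

/-- A continuous convex function has a subgradient everywhere: separate its strict epigraph from
the point of the graph, and represent the separating functional by reflexivity. -/
lemma exists_isSubgradient [FiniteDimensional ℝ Y] {f : StrongDual ℝ Y → ℝ}
    (hf : ConvexOn ℝ univ f) (hfc : Continuous f) (z : StrongDual ℝ Y) :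
    ∃ g, IsSubgradient f z g := by
  have hopen : IsOpen {p : StrongDual ℝ Y × ℝ | f p.1 < p.2} :=
    isOpen_lt (hfc.comp continuous_fst) continuous_snd
  have hconv : Convex ℝ {p : StrongDual ℝ Y × ℝ | f p.1 < p.2} := by
    simpa using hf.convex_strict_epigraph
  obtain ⟨φ, hφ⟩ := geometric_hahn_banach_point_open (x := (z, f z)) hconv hopen (by simp)
  have hφ' : ∀ w r, φ (w, r) = φ (w, 0) + r * φ (0, 1) := by
    intro w r
    rw [← smul_eq_mul, ← map_smul, ← map_add]
    simp
  set c := φ (0, 1) with hc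
  have hlt : ∀ w r, f w < r → φ (z, 0) + f z * c < φ (w, 0) + r * c := by
    intro w r hr
    rw [← hφ', ← hφ']
    exact hφ (w, r) hr
  have hcpos : 0 < c := by linarith [hlt z (f z + 1) (by linarith)]
  have hle : ∀ w, φ (z, 0) + f z * c ≤ φ (w, 0) + f w * c := by
    intro w
    refine le_of_forall_pos_lt_add fun ε hε => ?_
    have := hlt w (f w + ε / c) (by have := div_pos hε hcpos; linarith)
    rwa [add_mul, div_mul_cancel₀ _ hcpos.ne', ← add_assoc] at this
  have hsurj : Function.Surjective (NormedSpace.inclusionInDoubleDual ℝ Y) := by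
    refine (LinearMap.injective_iff_surjective_of_finrank_eq_finrank
      (f := (NormedSpace.inclusionInDoubleDual ℝ Y).toLinearMap) ?_).1
        (NormedSpace.inclusionInDoubleDualLi (E := Y) ℝ).injective
    have e : ∀ (V : Type _) [NormedAddCommGroup V] [NormedSpace ℝ V] [FiniteDimensional ℝ V],
        Module.finrank ℝ (StrongDual ℝ V) = Module.finrank ℝ V := fun V _ _ _ => by
      rw [← Subspace.dual_finrank_eq (K := ℝ) (V := V)]
      exact (LinearMap.toContinuousLinearMap (𝕜 := ℝ) (E := V) (F' := ℝ)).symm.finrank_eq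
    rw [e, e]
  obtain ⟨g, hg⟩ := hsurj (-(c⁻¹ • φ.comp (ContinuousLinearMap.inl ℝ (StrongDual ℝ Y) ℝ)))
  refine ⟨g, fun w => ?_⟩
  have h1 : (w - z) g = -(c⁻¹ * (φ (w, 0) - φ (z, 0))) := by
    rw [← NormedSpace.dual_def ℝ Y g, hg]
    have h0 : φ (w - z, 0) = φ (w, 0) - φ (z, 0) := by simp [← map_sub]
    simp [← h0]
  have h2 := hle w
  have h3 : c⁻¹ * (φ (w, 0) - φ (z, 0)) ≥ f z - f w := by
    rw [ge_iff_le, inv_mul_eq_div, le_div_iff₀ hcpos]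
    linarith
  rw [h1]
  linarith

end Dual

/-! ### The dual objective -/

section Objective

variable {X Y : Type*} [NormedAddCommGroup X] [NormedSpace ℝ X]
  [NormedAddCommGroup Y] [NormedSpace ℝ Y]

lemma negAdj_apply (A : X →L[ℝ] StrongDual ℝ Y) (y : Y) (x : X) : negAdj A y x = -(A x y) := by
  simp [negAdj]

lemma continuous_negAdj (A : X →L[ℝ] StrongDual ℝ Y) : Continuous (negAdj A) :=
  A.flip.continuous.neg

lemma mem_effDom_dualObj_iff {f : StrongDual ℝ Y → ℝ} {h : X → EReal}
    (hh : IsProperClosedConvex h) {A : X →L[ℝ] StrongDual ℝ Y} {y : Y} :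
    y ∈ effDom (dualObj f h A) ↔
      negAdj A y ∈ effDom (conj h) ∧ y ∈ effDom (conjDual f) := by
  simp only [mem_effDom_iff, dualObj]
  rw [EReal.add_ne_top_iff_ne_top₂ (conj_ne_bot hh _) (conjDual_ne_bot f y)]

lemma dualObj_eq_coe {f : StrongDual ℝ Y → ℝ} {h : X → EReal}
    (hh : IsProperClosedConvex h) {A : X →L[ℝ] StrongDual ℝ Y} {y : Y}
    (hy : y ∈ effDom (dualObj f h A)) : dualObj f h A y =
      (((conj h (negAdj A y)).toReal + (conjDual f y).toReal : ℝ) : EReal) := by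
  obtain ⟨h1, h2⟩ := (mem_effDom_dualObj_iff hh).1 hy
  rw [EReal.coe_add, coe_toReal_conj hh h1, coe_toReal_conjDual h2, dualObj]

lemma lowerSemicontinuous_dualObj {f : StrongDual ℝ Y → ℝ} (hf : ConvexOn ℝ univ f)
    (hfc : Continuous f) {h : X → EReal} (hh : IsProperClosedConvex h)
    (A : X →L[ℝ] StrongDual ℝ Y) : LowerSemicontinuous (dualObj f h A) :=
  ((lowerSemicontinuous_conj hh).comp (continuous_negAdj A)).add'
    (lowerSemicontinuous_conjDual hf hfc) fun y =>
      EReal.continuousAt_add (Or.inr (conjDual_ne_bot f y)) (Or.inl (conj_ne_bot hh _))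

lemma isCompact_sublevel_dualObj [FiniteDimensional ℝ Y] {f : StrongDual ℝ Y → ℝ} {L : ℝ≥0}
    (hf : ConvexOn ℝ univ f) (hfl : LipschitzWith L f) {h : X → EReal}
    (hh : IsProperClosedConvex h) (A : X →L[ℝ] StrongDual ℝ Y) {s₀ : Y}
    (hs₀ : s₀ ∈ effDom (dualObj f h A)) :
    IsCompact {y | dualObj f h A y ≤ dualObj f h A s₀} := by
  have := FiniteDimensional.proper_real Y
  refine Metric.isCompact_of_isClosed_isBounded
    ((lowerSemicontinuous_dualObj hf hfl.continuous hh A).isClosed_preimage _) ?_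
  refine (Metric.isBounded_closedBall (x := (0 : Y)) (r := L)).subset fun y hy => ?_
  have hy' : y ∈ effDom (dualObj f h A) := (show dualObj f h A y ≤ _ from hy).trans_lt hs₀
  simpa using norm_le_of_mem_effDom_conjDual hfl ((mem_effDom_dualObj_iff hh).1 hy').2

lemma exists_isMin_dualObj [FiniteDimensional ℝ Y] {f : StrongDual ℝ Y → ℝ} {L : ℝ≥0}
    (hf : ConvexOn ℝ univ f) (hfl : LipschitzWith L f) {h : X → EReal}
    (hh : IsProperClosedConvex h) (A : X →L[ℝ] StrongDual ℝ Y) {s₀ : Y}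
    (hs₀ : s₀ ∈ effDom (dualObj f h A)) : ∃ y ∈ effDom (dualObj f h A),
      dualValue f h A = dualObj f h A y := by
  obtain ⟨y, hy, hmin⟩ :=
    ((lowerSemicontinuous_dualObj hf hfl.continuous hh A).lowerSemicontinuousOn _).exists_isMinOn
      ⟨s₀, le_refl (dualObj f h A s₀)⟩
      (isCompact_sublevel_dualObj hf hfl hh A hs₀)
  refine ⟨y, (show dualObj f h A y ≤ _ from hy).trans_lt hs₀,
    le_antisymm (iInf_le _ y) (le_iInf fun z => ?_)⟩
  rcases le_total (dualObj f h A z) (dualObj f h A s₀) with hz | hz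
  · exact hmin hz
  · exact le_trans hy hz

lemma negAdj_mem_setU {f : StrongDual ℝ Y → ℝ} (A : X →L[ℝ] StrongDual ℝ Y) {y : Y}
    (hy : y ∈ effDom (conjDual f)) : negAdj A y ∈ setU f A :=
  ⟨y, subset_closure hy, rfl⟩

lemma isCompact_setU [FiniteDimensional ℝ Y] {f : StrongDual ℝ Y → ℝ} {L : ℝ≥0}
    (hfl : LipschitzWith L f) (A : X →L[ℝ] StrongDual ℝ Y) : IsCompact (setU f A) := by
  have := FiniteDimensional.proper_real Y
  refine IsCompact.image ?_ (continuous_negAdj A)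
  refine Bornology.IsBounded.isCompact_closure ?_
  refine (Metric.isBounded_closedBall (x := (0 : Y)) (r := L)).subset fun y hy => ?_
  simpa using norm_le_of_mem_effDom_conjDual hfl hy

lemma isProxPoint_iff {h : X → EReal} (hh : IsProperClosedConvex h) (A : X →L[ℝ] StrongDual ℝ Y)
    (s : Y) (x : X) : IsProxPoint h A s x ↔ IsConjMaximizer h (negAdj A s) x := by
  have hfin : ∀ z ∈ effDom h, ((A z s : ℝ) : EReal) + h z =
      ((A z s + (h z).toReal : ℝ) : EReal) := by
    intro z hz
    rw [EReal.coe_add, hh.coe_toReal hz]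
  constructor
  · intro hx
    obtain ⟨x₀, hx₀⟩ := hh.nonempty_effDom
    have hxd : x ∈ effDom h := by
      rw [mem_effDom_iff]
      intro htop
      have h1 := hx x₀
      rw [htop, EReal.coe_add_top, hfin x₀ hx₀] at h1
      exact absurd h1 (not_le.2 (EReal.coe_lt_top _))
    refine ⟨hxd, fun z hz => ?_⟩
    have h1 := hx z
    rw [hfin z hz, hfin x hxd, EReal.coe_le_coe_iff] at h1
    rw [negAdj_apply, negAdj_apply]
    linarith
  · intro hx z
    by_cases hz : z ∈ effDom h
    · have h1 := hx.2 z hz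
      rw [negAdj_apply, negAdj_apply] at h1
      rw [hfin z hz, hfin x hx.1, EReal.coe_le_coe_iff]
      linarith
    · have : h z = ⊤ := by simpa [mem_effDom_iff] using hz
      simp [this]

end Objective

/-! ### Rates for the scalar recursion -/

section Rates

lemma stepβ_succ (k : ℕ) : stepβ (k + 1) = stepβ k + stepα k := by
  simp only [stepβ, stepα]
  push_cast
  ring

lemma stepβ_succ_pos (k : ℕ) : 0 < stepβ (k + 1) := by
  simp only [stepβ]
  positivity

lemma stepβ_mul_stepτ (k : ℕ) : stepβ (k + 1) * stepτ k = stepα k :=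
  mul_div_cancel₀ _ (stepβ_succ_pos k).ne'

lemma stepτ_eq (k : ℕ) : stepτ k = 2 / ((k : ℝ) + 2) := by
  simp only [stepτ, stepα, stepβ]
  push_cast
  field_simp
  ring

lemma stepτ_mem_Icc (k : ℕ) : stepτ k ∈ Icc (0 : ℝ) 1 := by
  rw [stepτ_eq]
  refine ⟨by positivity, ?_⟩
  rw [div_le_one (by positivity)]
  linarith [Nat.cast_nonneg (α := ℝ) k]

lemma stepβ_mul_sq_stepτ_le (k : ℕ) : stepβ (k + 1) * stepτ k ^ 2 ≤ 2 := by
  rw [pow_two, ← mul_assoc, stepβ_mul_stepτ, stepτ_eq, stepα, mul_div_assoc',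
    div_le_iff₀ (by positivity)]
  linarith

variable {d p : ℕ → ℝ} {c : ℝ}

/-- Weighting the recursion by `β_{k+1}` makes the sum of the primal values telescope. -/
lemma stepβ_mul_add_le (hc : 0 ≤ c)
    (hd : ∀ k, d (k + 1) ≤ d k - stepτ k * (p k + d k) + stepτ k ^ 2 * c) {q : ℝ} {k : ℕ}
    (hq : ∀ i < k, q ≤ p i) : stepβ k * (q + d k) ≤ 2 * c * k := by
  induction k with
  | zero => simp [stepβ]
  | succ k ih =>
    have h1 := ih fun i hi => hq i (hi.trans k.lt_succ_self)
    have h2 := mul_le_mul_of_nonneg_left (hd k) (stepβ_succ_pos k).le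
    have h3 := mul_le_mul_of_nonneg_right (stepβ_mul_sq_stepτ_le k) hc
    have h4 : stepβ (k + 1) * (d k - stepτ k * (p k + d k) + stepτ k ^ 2 * c) =
        stepβ (k + 1) * d k - stepβ (k + 1) * stepτ k * (p k + d k) +
          stepβ (k + 1) * stepτ k ^ 2 * c := by ring
    rw [h4, stepβ_mul_stepτ] at h2
    have h5 : 0 ≤ stepα k * (p k - q) :=
      mul_nonneg (by simp only [stepα]; positivity)
        (sub_nonneg.2 (hq k k.lt_succ_self))
    rw [stepβ_succ] at h2 h3 ⊢
    push_cast
    linarith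

lemma add_le_of_recursion (hc : 0 ≤ c)
    (hd : ∀ k, d (k + 1) ≤ d k - stepτ k * (p k + d k) + stepτ k ^ 2 * c) {q : ℝ} {k : ℕ}
    (hk : 1 ≤ k) (hq : ∀ i < k, q ≤ p i) : q + d k ≤ 4 * c / (k + 1) := by
  have h1 := stepβ_mul_add_le hc hd hq
  have hk' : (0 : ℝ) < k := by exact_mod_cast hk
  rw [le_div_iff₀ (by positivity)]
  refine le_of_mul_le_mul_left ?_ hk'
  simp only [stepβ] at h1
  linarith

/-- The same weights make the sum of the gaps telescope, up to the terms `α_k (d_k - D_*)`, which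
are bounded because the dual suboptimality decays like `1 / k`. -/
lemma stepβ_mul_gap_add_le (hc : 0 ≤ c)
    (hd : ∀ k, d (k + 1) ≤ d k - stepτ k * (p k + d k) + stepτ k ^ 2 * c) {D m : ℝ}
    (hD : D ≤ d 0) (hp : ∀ k, -D ≤ p k) {k : ℕ} (hm : ∀ i < k, m ≤ p i + d i) :
    stepβ k * ((d k - D) + m) ≤ (d 0 - D) + 6 * c * k := by
  induction k with
  | zero => simpa [stepβ] using hD
  | succ k ih =>
    have h1 := ih fun i hi => hm i (hi.trans k.lt_succ_self)
    have h2 := mul_le_mul_of_nonneg_left (hd k) (stepβ_succ_pos k).le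
    have h3 := mul_le_mul_of_nonneg_right (stepβ_mul_sq_stepτ_le k) hc
    have h4 : stepβ (k + 1) * (d k - stepτ k * (p k + d k) + stepτ k ^ 2 * c) =
        stepβ (k + 1) * d k - stepβ (k + 1) * stepτ k * (p k + d k) +
          stepβ (k + 1) * stepτ k ^ 2 * c := by ring
    rw [h4, stepβ_mul_stepτ] at h2
    have h5 : 0 ≤ stepα k * (p k + d k - m) :=
      mul_nonneg (by simp only [stepα]; positivity)
        (sub_nonneg.2 (hm k k.lt_succ_self))
    rcases Nat.eq_zero_or_pos k with rfl | hk
    · have ha : stepα 0 = 1 := by simp [stepα]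
      have hb : stepβ 0 = 0 := by simp [stepβ]
      rw [stepβ_succ, ha, hb] at h2 h3 ⊢
      rw [ha] at h5
      simp only [zero_add] at h2 h3 ⊢
      push_cast
      linarith
    · have h6 : stepα k * (d k - D) ≤ 4 * c := by
        have := add_le_of_recursion hc hd hk fun i _ => hp i
        rw [le_div_iff₀ (by positivity)] at this
        simp only [stepα]
        linarith
      rw [stepβ_succ] at h2 h3 ⊢
      push_cast
      linarith

lemma gap_le_of_recursion (hc : 0 ≤ c)
    (hd : ∀ k, d (k + 1) ≤ d k - stepτ k * (p k + d k) + stepτ k ^ 2 * c) {D m : ℝ}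
    (hD : ∀ k, D ≤ d k) (hp : ∀ k, -D ≤ p k) {k : ℕ} (hk : 1 ≤ k)
    (hm : ∀ i < k, m ≤ p i + d i) :
    m ≤ 12 / (k : ℝ) ^ 2 * (d 0 - D) + 52 * c / k := by
  have h1 := stepβ_mul_gap_add_le hc hd (hD 0) hp hm
  have hk' : (0 : ℝ) < k := by exact_mod_cast hk
  have h2 : 0 ≤ d 0 - D := sub_nonneg.2 (hD 0)
  have h3 : 0 ≤ stepβ k * (d k - D) :=
    mul_nonneg (by simp only [stepβ]; positivity) (sub_nonneg.2 (hD k))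
  have h4 : 12 / (k : ℝ) ^ 2 * (d 0 - D) + 52 * c / k =
      (12 * (d 0 - D) + 52 * c * k) / (k : ℝ) ^ 2 := by
    field_simp
  rw [h4, le_div_iff₀ (by positivity)]
  rcases le_or_gt m 0 with hm0 | hm0
  · have : m * (k : ℝ) ^ 2 ≤ 0 := mul_nonpos_of_nonpos_of_nonneg hm0 (by positivity)
    have : 0 ≤ 12 * (d 0 - D) + 52 * c * k := by positivity
    linarith
  · have h5 : 0 ≤ m * k := by positivity
    have h6 : 0 ≤ c * k := by positivity
    simp only [stepβ] at h1 h3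
    linarith

end Rates

section Algorithm

variable {X Y : Type*} [NormedAddCommGroup X] [NormedSpace ℝ X]
  [NormedAddCommGroup Y] [NormedSpace ℝ Y]

/-! ### Strong convexity on `conv (∇h*(𝒰))` and the furthest distance -/

/-- No compactness of `conv (∇h*(𝒰))` itself is needed: it is contained in a convex set on which `h`
is strongly convex, so its own tightest constant is positive. -/
lemma strongConvexOn_setSbar [FiniteDimensional ℝ X] [FiniteDimensional ℝ Y]
    {A : X →L[ℝ] StrongDual ℝ Y} {f : StrongDual ℝ Y → ℝ} {L : ℝ≥0} (hf_lip : LipschitzWith L f)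
    {h : X → EReal} (hh : IsProperClosedConvex h) (hh_strong : LocallyStronglyConvex h)
    (hU : setU f A ⊆ interior (effDom (conj h))) (hne : (effDom (conjDual f)).Nonempty) :
    (setSbar f h A ⊆ effDom h ∧
      ∀ u ∈ setU f A, ∀ x, IsConjMaximizer h u x → x ∈ setSbar f h A) ∧
    0 < strongConvexityConst h (setSbar f h A) ∧
      StrongConvexOn (setSbar f h A) (strongConvexityConst h (setSbar f h A))
        fun x => (h x).toReal := by
  obtain ⟨y, hy⟩ := hne
  obtain ⟨S, hSc, hSd, hmem, ν, hν, hS⟩ := exists_strongConvexOn_maximizers hh hh_strong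
    (isCompact_setU hf_lip A) ⟨_, negAdj_mem_setU A hy⟩ hU
  have hsub : setSbar f h A ⊆ S := by
    refine convexHull_min ?_ hSc
    rintro x ⟨u, hu, hx⟩
    exact hmem u hu x ((isGradConj_iff_isConjMaximizer hh hh_strong (hU hu)).1 hx)
  refine ⟨⟨hsub.trans hSd, fun u hu x hx => subset_convexHull ℝ _
    ⟨u, hu, hx.isGradConj hh hh_strong (hU hu)⟩⟩, ?_⟩
  exact strongConvexityConst_pos_and_strongConvexOn hν
    ⟨convex_convexHull ℝ _, fun x hx y hy => hS.2 (hsub hx) (hsub hy)⟩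

lemma isGreatest_furthestDist {V W : Set (StrongDual ℝ X)} (hV : IsCompact V) (hW : IsCompact W)
    (hVne : V.Nonempty) (hWne : W.Nonempty) :
    IsGreatest (distances V W) (furthestDist V W) := by
  have heq : distances V W =
      (fun q : StrongDual ℝ X × StrongDual ℝ X => ‖q.1 - q.2‖) '' V ×ˢ W := by
    ext r
    constructor
    · rintro ⟨v, hv, w, hw, rfl⟩
      exact ⟨(v, w), ⟨hv, hw⟩, rfl⟩
    · rintro ⟨⟨v, w⟩, ⟨hv, hw⟩, rfl⟩
      exact ⟨v, hv, w, hw, rfl⟩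
  rw [furthestDist, heq]
  exact ((hV.prod hW).image (by fun_prop)).isGreatest_sSup ((hVne.prod hWne).image _)

/-! ### The dual descent inequality -/

lemma primalObj_eq_coe {f : StrongDual ℝ Y → ℝ} {h : X → EReal} (hh : IsProperClosedConvex h)
    (A : X →L[ℝ] StrongDual ℝ Y) {x : X} (hx : x ∈ effDom h) :
    primalObj f h A x = ((f (A x) + (h x).toReal : ℝ) : EReal) := by
  rw [EReal.coe_add, hh.coe_toReal hx, primalObj]

lemma weak_duality {f : StrongDual ℝ Y → ℝ} {h : X → EReal} (hh : IsProperClosedConvex h)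
    {A : X →L[ℝ] StrongDual ℝ Y} {x : X} (hx : x ∈ effDom h) {y : Y}
    (hy : y ∈ effDom (dualObj f h A)) :
    0 ≤ (f (A x) + (h x).toReal) + ((conj h (negAdj A y)).toReal + (conjDual f y).toReal) := by
  obtain ⟨h1, h2⟩ := (mem_effDom_dualObj_iff hh).1 hy
  have h3 := sub_le_toReal_conj hh h1 hx
  have h4 := sub_le_toReal_conjDual h2 (A x)
  rw [negAdj_apply] at h3
  linarith

/-- One step towards a subgradient decreases the dual objective by `τ` times the primal-dual gap,
up to the curvature term `τ² ℓ² / (2 μ)`. -/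
lemma dual_descent {A : X →L[ℝ] StrongDual ℝ Y} {f : StrongDual ℝ Y → ℝ}
    (hf : ConvexOn ℝ univ f) (hfc : Continuous f)
    {h : X → EReal} (hh : IsProperClosedConvex h) {S : Set X} {μ ℓ : ℝ} (hμ : 0 < μ)
    (hSd : S ⊆ effDom h) (hS : StrongConvexOn S μ fun x => (h x).toReal)
    {s g : Y} {x z : X} {t : ℝ} (ht : t ∈ Icc (0 : ℝ) 1) (hs : s ∈ effDom (dualObj f h A))
    (hx : IsConjMaximizer h (negAdj A s) x) (hxS : x ∈ S) (hg : IsSubgradient f (A x) g)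
    (hz : IsConjMaximizer h (negAdj A ((1 - t) • s + t • g)) z) (hzS : z ∈ S)
    (hℓ : ‖negAdj A s - negAdj A g‖ ≤ ℓ) :
    (conj h (negAdj A ((1 - t) • s + t • g))).toReal +
        (conjDual f ((1 - t) • s + t • g)).toReal ≤
      ((conj h (negAdj A s)).toReal + (conjDual f s).toReal) -
        t * ((f (A x) + (h x).toReal) +
          ((conj h (negAdj A s)).toReal + (conjDual f s).toReal)) +
        t ^ 2 * (ℓ ^ 2 / (2 * μ)) := by
  have hgd := hg.mem_effDom_conjDual
  have hgval := hg.toReal_conjDual_eq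
  have h1 := (convexOn_toReal_conjDual hf hfc).2 ((mem_effDom_dualObj_iff hh).1 hs).2 hgd
    (sub_nonneg.2 ht.2) ht.1 (by ring)
  have h2 := toReal_conj_le_quadratic hh hμ hSd hS hx hxS hz hzS
  have h3 : negAdj A ((1 - t) • s + t • g) - negAdj A s = t • (negAdj A g - negAdj A s) := by
    ext w
    simp only [negAdj_apply, sub_apply, smul_apply, map_add, map_smul, smul_eq_mul]
    ring
  have h4 : ‖t • (negAdj A g - negAdj A s)‖ ^ 2 / (2 * μ) ≤ t ^ 2 * (ℓ ^ 2 / (2 * μ)) := by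
    rw [norm_smul, mul_pow, Real.norm_of_nonneg ht.1, mul_div_assoc, norm_sub_rev]
    gcongr
  rw [h3, smul_apply, sub_apply, negAdj_apply, negAdj_apply, smul_eq_mul] at h2
  have h5 := hx.toReal_conj_eq hh
  rw [negAdj_apply] at h5
  simp only [smul_eq_mul, hgval] at h1
  have h6 : t * (conj h (negAdj A s)).toReal = t * (-(A x) s - (h x).toReal) := by rw [h5]
  linarith

/-! ### Runs of the algorithm -/

lemma exists_isMonotoneDARun {A : X →L[ℝ] StrongDual ℝ Y} {f : StrongDual ℝ Y → ℝ} {h : X → EReal}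
    (hprox : ∀ s ∈ effDom (dualObj f h A), ∃ x, IsProxPoint h A s x)
    (hsub : ∀ z, ∃ g, IsSubgradient f z g) {s₀ : Y} (hs₀ : s₀ ∈ effDom (dualObj f h A)) :
    ∃ (s : ℕ → Y) (x : ℕ → X) (g : ℕ → Y), IsMonotoneDARun f h A s₀ s x g := by
  classical
  choose! px hpx using hprox
  choose gr hgr using hsub
  -- the primal point and the subgradient are fixed functions of the dual iterate
  let next : ℕ → Y → Y := fun k s => (1 - stepτ k) • s + stepτ k • gr (A (px s))
  obtain ⟨s, hzero, hsucc⟩ : ∃ s : ℕ → Y, s 0 = s₀ ∧ ∀ k, s (k + 1) =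
      if dualObj f h A (next k (s k)) < dualObj f h A (s k) then next k (s k) else s k :=
    ⟨fun n => Nat.rec s₀ (fun k s =>
      if dualObj f h A (next k s) < dualObj f h A s then next k s else s) n, rfl, fun _ => rfl⟩
  have hdom : ∀ k, s k ∈ effDom (dualObj f h A) := by
    intro k
    induction k with
    | zero => rwa [hzero]
    | succ k ih =>
      rw [hsucc]
      split_ifs with hlt
      · exact hlt.trans ih
      · exact ih
  refine ⟨s, fun k => px (s k), fun k => gr (A (px (s k))), hs₀, hzero,
    hpx _ (hdom 0), hgr _, ?_, ?_⟩
  · intro k hk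
    exact ⟨(hsucc k).trans (if_pos hk), hpx (s (k + 1)) (hdom (k + 1)), hgr (A (px (s (k + 1))))⟩
  · intro k hk
    have : s (k + 1) = s k := (hsucc k).trans (if_neg hk)
    simp [this]

lemma IsMonotoneDARun.invariant {A : X →L[ℝ] StrongDual ℝ Y} {f : StrongDual ℝ Y → ℝ}
    {h : X → EReal} {s₀ : Y} {s : ℕ → Y} {x : ℕ → X} {g : ℕ → Y}
    (hr : IsMonotoneDARun f h A s₀ s x g) (k : ℕ) :
    dualObj f h A (s k) ≤ dualObj f h A s₀ ∧ IsProxPoint h A (s k) (x k) ∧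
      IsSubgradient f (A (x k)) (g k) := by
  induction k with
  | zero => exact ⟨by rw [hr.init_s], hr.init_x, hr.init_g⟩
  | succ k ih =>
    by_cases hk : dualObj f h A (trial s g k) < dualObj f h A (s k)
    · obtain ⟨h1, h2, h3⟩ := hr.active k hk
      exact ⟨by rw [h1]; exact hk.le.trans ih.1, h2, h3⟩
    · obtain ⟨h1, h2, h3⟩ := hr.idle k hk
      rw [h1, h2, h3]
      exact ih

lemma IsMonotoneDARun.dualObj_succ_le_trial {A : X →L[ℝ] StrongDual ℝ Y} {f : StrongDual ℝ Y → ℝ}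
    {h : X → EReal} {s₀ : Y} {s : ℕ → Y} {x : ℕ → X} {g : ℕ → Y}
    (hr : IsMonotoneDARun f h A s₀ s x g) (k : ℕ) :
    dualObj f h A (s (k + 1)) ≤ dualObj f h A (trial s g k) := by
  by_cases hk : dualObj f h A (trial s g k) < dualObj f h A (s k)
  · rw [(hr.active k hk).1]
  · rw [(hr.idle k hk).1]
    exact not_lt.1 hk

end Algorithm

end DualAveraging

open DualAveraging

theorem mainTheorem3
    {X Y : Type*} [NormedAddCommGroup X] [NormedSpace ℝ X] [FiniteDimensional ℝ X]
    [NormedAddCommGroup Y] [NormedSpace ℝ Y] [FiniteDimensional ℝ Y]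
    (A : X →L[ℝ] StrongDual ℝ Y)
    (f : StrongDual ℝ Y → ℝ) (L : ℝ≥0) (hf_convex : ConvexOn ℝ univ f)
    (hf_lip : LipschitzWith L f)
    (h : X → EReal) (hh : DualAveraging.IsProperClosedConvex h)
    (hh_strong : DualAveraging.LocallyStronglyConvex h)
    (hU : DualAveraging.setU f A ⊆ interior (DualAveraging.effDom (DualAveraging.conj h)))
    (s₀ : Y) (hs₀ : s₀ ∈ DualAveraging.effDom (DualAveraging.dualObj f h A))
    (μ : ℝ)
    (hμ : μ = DualAveraging.strongConvexityConst h (DualAveraging.setSbar f h A))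
    (ℓ : ℝ)
    (hℓ : ℓ = DualAveraging.furthestDist (DualAveraging.setUbar f h A s₀)
      (DualAveraging.setU f A)) :
    -- the constants `μ`, `ℓ` and `D_*` of the rates are well defined
    0 < μ ∧
    IsGreatest (DualAveraging.distances (DualAveraging.setUbar f h A s₀)
      (DualAveraging.setU f A)) ℓ ∧
    (∃ Dstar : ℝ, DualAveraging.dualValue f h A = (Dstar : EReal) ∧
      ∃ y : Y, DualAveraging.dualObj f h A y = (Dstar : EReal)) ∧
    -- the algorithm is well defined
    (∃ (s : ℕ → Y) (x : ℕ → X) (g : ℕ → Y), DualAveraging.IsMonotoneDARun f h A s₀ s x g) ∧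
    -- the convergence rates
    ∀ (s : ℕ → Y) (x : ℕ → X) (g : ℕ → Y), DualAveraging.IsMonotoneDARun f h A s₀ s x g →
      ∀ k : ℕ, 1 ≤ k →
        (⨅ i : Fin k, DualAveraging.primalObj f h A (x i) + DualAveraging.dualObj f h A (s i)) ≤
            ((12 / (k : ℝ) ^ 2 : ℝ) : EReal) *
              (DualAveraging.dualObj f h A (s 0) - DualAveraging.dualValue f h A) +
            ((26 * ℓ ^ 2 / (μ * k) : ℝ) : EReal) ∧
        ∀ xhat : X, DualAveraging.IsBestIterate f h A x k xhat →
          DualAveraging.primalObj f h A xhat + DualAveraging.dualObj f h A (s k) ≤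
            ((2 * ℓ ^ 2 / (μ * ((k : ℝ) + 1)) : ℝ) : EReal) := by
  have hfc := hf_lip.continuous
  have hs₀' := (mem_effDom_dualObj_iff hh).1 hs₀
  obtain ⟨⟨hSd, hSmem⟩, hμpos, hS⟩ :=
    strongConvexOn_setSbar hf_lip hh hh_strong hU ⟨s₀, hs₀'.2⟩
  rw [← hμ] at hμpos hS
  have hgr : IsGreatest (distances (setUbar f h A s₀) (setU f A)) ℓ := by
    rw [hℓ]
    exact isGreatest_furthestDist
      ((isCompact_sublevel_dualObj hf_convex hf_lip hh A hs₀).image (continuous_negAdj A))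
      (isCompact_setU hf_lip A) ⟨_, s₀, le_refl (dualObj f h A s₀), rfl⟩
      ⟨_, negAdj_mem_setU A hs₀'.2⟩
  obtain ⟨y, hy, hval⟩ := exists_isMin_dualObj hf_convex hf_lip hh A hs₀
  have hmax : ∀ s ∈ effDom (conjDual f), ∃ x, IsConjMaximizer h (negAdj A s) x := fun s hs =>
    exists_isConjMaximizer hh (hU (negAdj_mem_setU A hs))
  set Dr : Y → ℝ := fun y => (conj h (negAdj A y)).toReal + (conjDual f y).toReal with hDr
  have hDcoe : ∀ y ∈ effDom (dualObj f h A), dualObj f h A y = (Dr y : EReal) :=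
    fun y hy => dualObj_eq_coe hh hy
  refine ⟨hμpos, hgr, ⟨Dr y, by rw [hval, hDcoe y hy], y, hDcoe y hy⟩,
    exists_isMonotoneDARun (fun s hs => ?_) (exists_isSubgradient hf_convex hfc) hs₀, ?_⟩
  · obtain ⟨x, hx⟩ := hmax s ((mem_effDom_dualObj_iff hh).1 hs).2
    exact ⟨x, (isProxPoint_iff hh A s x).2 hx⟩
  intro s x g hr k hk
  have hsd : ∀ i, s i ∈ effDom (dualObj f h A) := fun i => (hr.invariant i).1.trans_lt hs₀
  have hxm : ∀ i, IsConjMaximizer h (negAdj A (s i)) (x i) := fun i =>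
    (isProxPoint_iff hh A _ _).1 (hr.invariant i).2.1
  set p : ℕ → ℝ := fun i => f (A (x i)) + (h (x i)).toReal with hp
  have hPcoe : ∀ i, primalObj f h A (x i) = (p i : EReal) := fun i =>
    primalObj_eq_coe hh A (hxm i).1
  have hfdom : ∀ i, s i ∈ effDom (conjDual f) := fun i => ((mem_effDom_dualObj_iff hh).1 (hsd i)).2
  have hxS : ∀ i, x i ∈ setSbar f h A := fun i =>
    hSmem _ (negAdj_mem_setU A (hfdom i)) _ (hxm i)
  have hgd : ∀ i, g i ∈ effDom (conjDual f) := fun i =>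
    (hr.invariant i).2.2.mem_effDom_conjDual
  set c := ℓ ^ 2 / (2 * μ) with hc
  have hc0 : 0 ≤ c := by positivity
  -- the descent inequality holds for active and idle steps alike
  have hrec : ∀ i, Dr (s (i + 1)) ≤
      Dr (s i) - stepτ i * (p i + Dr (s i)) + stepτ i ^ 2 * c := by
    intro i
    have hτ := stepτ_mem_Icc i
    have htd : trial s g i ∈ effDom (conjDual f) :=
      (convexOn_toReal_conjDual hf_convex hfc).1 (hfdom i) (hgd i) (sub_nonneg.2 hτ.2) hτ.1
        (by ring)
    have hU' := negAdj_mem_setU A htd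
    obtain ⟨z, hz⟩ := hmax _ htd
    have htD : trial s g i ∈ effDom (dualObj f h A) :=
      (mem_effDom_dualObj_iff hh).2 ⟨interior_subset (hU hU'), htd⟩
    have hle := hr.dualObj_succ_le_trial i
    rw [hDcoe _ (hsd _), hDcoe _ htD, EReal.coe_le_coe_iff] at hle
    exact hle.trans (dual_descent hf_convex hfc hh hμpos hSd hS hτ (hsd i) (hxm i) (hxS i)
      (hr.invariant i).2.2 hz (hSmem _ hU' z hz)
      (hgr.2 ⟨_, ⟨s i, (hr.invariant i).1, rfl⟩, _, negAdj_mem_setU A (hgd i), rfl⟩))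
  constructor
  · have : Nonempty (Fin k) := ⟨⟨0, hk⟩⟩
    obtain ⟨j, hj⟩ := Finite.exists_min fun i : Fin k => p i + Dr (s i)
    have hDle : ∀ i, Dr y ≤ Dr (s i) := fun i => by
      have h1 : dualValue f h A ≤ dualObj f h A (s i) := iInf_le _ _
      rwa [hval, hDcoe y hy, hDcoe _ (hsd i), EReal.coe_le_coe_iff] at h1
    have hrate := gap_le_of_recursion (d := fun i => Dr (s i)) hc0 hrec hDle
      (fun i => by linarith [weak_duality hh (hxm i).1 hy]) hk
      (m := p j + Dr (s j)) (fun i hi => hj ⟨i, hi⟩)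
    -- `c = ℓ² / (2μ)` turns the factor `52` of the scalar rate into `26`
    have h52 : 52 * c / k = 26 * ℓ ^ 2 / (μ * k) := by
      rw [hc]
      field_simp
      ring
    rw [h52] at hrate
    refine (iInf_le _ j).trans ?_
    rw [hPcoe, hDcoe _ (hsd _), hDcoe _ (hsd 0), hval, hDcoe y hy]
    exact_mod_cast hrate
  · rintro xhat ⟨⟨j, -, rfl⟩, hbest⟩
    have hrate := add_le_of_recursion (d := fun i => Dr (s i)) hc0 hrec (q := p j) hk fun i hi => by
      have h1 := hbest i hi.le
      rwa [hPcoe, hPcoe, EReal.coe_le_coe_iff] at h1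
    have h4 : 4 * c / (k + 1) = 2 * ℓ ^ 2 / (μ * ((k : ℝ) + 1)) := by
      rw [hc]
      field_simp
      ring
    rw [h4] at hrate
    rw [hPcoe, hDcoe _ (hsd _)]
    exact_mod_cast hrate
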